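/- Let $c$ be an indeterminate (or an element of any commutative ring). The associated Hermite polynomials are defined by $H_{-1}(x;c)=0$, $H_0(x;c)=1$ and $H_{n+1}(x;c)=xH_n(x;c)-(n-1+c)H_{n-1}(x;c)$. Let $\mathcal L_c$ be the unique linear functional on polynomials in $x$ with $\mathcal L_c(1)=1$ and $\mathcal L_c(H_m(x;c)H_n(x;c))=0$ for all $m\neq n$, and let $\mu_n(c)=\mathcal L_c(x^n)$ be its moments. A complete matching on the points $1,\dots,N$ is a partition of these points into pairs (edges). An edge $\{i<j\}$ is nested by an edge $\{a<b\}$ if $a<i<j<b$, and a point $k$ is nested by $\{a<b\}$ if $a<k<b$. A complete matching is connected if every point other than $1$ and $N$ is nested by some edge. A rooted map is a connected graph (loops and multiple edges allowed) cellularly embedded in a closed oriented surface, with one oriented (root) edge, up to orientation-preserving isomorphism; combinatorially, it is a rotation of the half-edges around the vertices together with the pairing of the half-edges into edges and a distinguished half-edge, the one at the head of the root edge. The map with one vertex and no edge counts as the single rooted map with $0$ edges, and its vertex is its root vertex; for a map with edges the root vertex is the one at the head of the root edge. Then for every integer $n\ge 0$ the following three generating functions are all equal to the moment $\mu_{2n}(c+1)$: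 (1) the generating function of rooted maps with $n$ edges in orientable surfaces, in which each vertex other than the root vertex has weight $c$; (2) the generating function of connected matchings on $2n+2$ points, in which each edge that is not nested by another edge has weight $c$, except the edge containing point $1$, which has weight $1$, as do all nested edges; (3) the generating function of complete matchings on $2n$ points, in which each edge that is not nested by another edge may have weight $1$ or $c$ (that is, it contributes the factor $c+1$), and all other edges have weight $1$. -/

import Mathlib

open Polynomial

/-! ## Associated Hermite polynomials and their moments -/

section Moments

variable {R : Type*} [CommRing R]

/-- The associated Hermite polynomial `H_n(x; c)`, given by `H_0 = 1`, `H_{-1} = 0` and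
`H_{n+1}(x; c) = x H_n(x; c) - (n - 1 + c) H_{n-1}(x; c)`. -/
noncomputable def assocHermite (c : R) : ℕ → R[X]
  | 0 => 1
  | 1 => X
  | n + 2 => X * assocHermite c (n + 1) - C ((n : R) + c) * assocHermite c n

/-- `L` is a normalized linear functional for which the polynomials `H_n(x; c)` are orthogonal. -/
structure IsHermiteFunctional (c : R) (L : R[X] →ₗ[R] R) : Prop where
  map_one : L 1 = 1
  orthogonal : ∀ m n : ℕ, m ≠ n → L (assocHermite c m * assocHermite c n) = 0

theorem X_mul_assocHermite (c : R) (n : ℕ) :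
    X * assocHermite c (n + 1) =
      assocHermite c (n + 2) + C ((n : R) + c) * assocHermite c n := by
  rw [assocHermite]; ring

/-- The operator of multiplication by `x` in the coordinates `H_0, H_1, …`. -/
noncomputable def hermiteShift (c : R) : Module.End R (ℕ →₀ R) :=
  Finsupp.linearCombination R fun n : ℕ =>
    Finsupp.single (n + 1) (1 : R) + match n with
      | 0 => 0
      | k + 1 => Finsupp.single k ((k : R) + c)

theorem aeval_hermiteShift (c : R) (n : ℕ) :
    aeval (hermiteShift c) (assocHermite c n) (Finsupp.single 0 1) = Finsupp.single n 1 := by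
  induction n using Nat.strong_induction_on with
  | _ n ih =>
    match n with
    | 0 => simp [assocHermite]
    | 1 => simp [assocHermite, hermiteShift]
    | n + 2 =>
      rw [assocHermite, map_sub, map_mul, map_mul, LinearMap.sub_apply, Module.End.mul_apply,
        Module.End.mul_apply, ih (n + 1) (by omega), ih n (by omega)]
      simp [hermiteShift, aeval_X, aeval_C, Module.algebraMap_end_apply]

/-- The polynomials `H_n(x; c)` have exactly one normalized orthogonality functional. -/
theorem existsUnique_isHermiteFunctional (c : R) :
    ∃! L : R[X] →ₗ[R] R, IsHermiteFunctional c L := by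
  let L : R[X] →ₗ[R] R := (Finsupp.lapply 0).comp
    ((LinearMap.applyₗ (Finsupp.single 0 1 : ℕ →₀ R)).comp (aeval (hermiteShift c)).toLinearMap)
  have hL : ∀ n, L (assocHermite c n) = if n = 0 then 1 else 0 := by
    intro n
    have : L (assocHermite c n) =
        (aeval (hermiteShift c) (assocHermite c n) (Finsupp.single 0 1)) 0 := rfl
    rw [this, aeval_hermiteShift, Finsupp.single_apply]
  have hC : ∀ (a : R) (p : R[X]), L (C a * p) = a * L p := by
    intro a p
    rw [← smul_eq_C_mul, map_smul, smul_eq_mul]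
  have key : ∀ m n : ℕ, m < n → L (assocHermite c m * assocHermite c n) = 0 := by
    intro m
    induction m using Nat.strong_induction_on with
    | _ m ih =>
      intro n hn
      obtain ⟨k, rfl⟩ : ∃ k, n = k + 1 := ⟨n - 1, by omega⟩
      match m with
      | 0 => simp [assocHermite, hL]
      | 1 =>
        have h1 : assocHermite c 1 = X := by rw [assocHermite]
        rw [h1, X_mul_assocHermite, map_add, hC, hL, hL]
        have : k ≠ 0 := by omega
        simp [this]
      | m + 2 =>
        have e : assocHermite c (m + 2) * assocHermite c (k + 1) =
            assocHermite c (m + 1) * assocHermite c (k + 2)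
              + C ((k : R) + c) * (assocHermite c (m + 1) * assocHermite c k)
              - C ((m : R) + c) * (assocHermite c m * assocHermite c (k + 1)) := by
          have h1 := X_mul_assocHermite c k
          rw [assocHermite]
          linear_combination (assocHermite c (m + 1)) * h1
        rw [e, map_sub, map_add, hC, hC, ih (m + 1) (by omega) _ (by omega),
          ih (m + 1) (by omega) _ (by omega), ih m (by omega) _ (by omega)]
        simp
  refine ⟨L, ⟨?_, ?_⟩, ?_⟩
  · have := hL 0
    simpa [assocHermite] using this
  · intro m n hmn
    rcases lt_or_gt_of_ne hmn with h | h
    · exact key m n h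
    · rw [mul_comm]; exact key n m h
  · intro L' h'
    have hL' : ∀ n, L' (assocHermite c n) = L (assocHermite c n) := by
      intro n
      rw [hL]
      rcases eq_or_ne n 0 with rfl | hn
      · simpa [assocHermite] using h'.map_one
      · have := h'.orthogonal n 0 hn
        simpa [assocHermite, hn] using this
    have hX : ∀ k n, L' (X ^ k * assocHermite c n) = L (X ^ k * assocHermite c n) := by
      intro k
      induction k with
      | zero => intro n; simpa using hL' n
      | succ k ih =>
        intro n
        rcases n with _ | n
        · have h1 := ih 1
          have h0 : (X : R[X]) ^ (k + 1) * assocHermite c 0 = X ^ k * assocHermite c 1 := by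
            simp [assocHermite, pow_succ]
          rw [h0]; exact h1
        · have e : (X : R[X]) ^ (k + 1) * assocHermite c (n + 1) =
              X ^ k * assocHermite c (n + 2)
                + ((n : R) + c) • (X ^ k * assocHermite c n) := by
            rw [smul_eq_C_mul]
            linear_combination (X : R[X]) ^ k * X_mul_assocHermite c n
          rw [e, map_add, map_add, map_smul, map_smul, ih, ih]
    refine Polynomial.lhom_ext' fun k => LinearMap.ext_ring ?_
    have := hX k 0
    simpa [assocHermite, X_pow_eq_monomial] using this

/-- The linear functional `L_c` for which the polynomials `H_n(x; c)` are orthogonal. -/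
noncomputable def hermiteFunctional (c : R) : R[X] →ₗ[R] R :=
  (existsUnique_isHermiteFunctional c).choose

/-- The moment `μ_n(c) = L_c(x ^ n)` of the associated Hermite polynomials. -/
noncomputable def hermiteMoment (c : R) (n : ℕ) : R := hermiteFunctional c (X ^ n)

end Moments

/-! ## Complete matchings -/

/-- Complete matchings of `N` points on a line (numbered from `0`), as fixed-point-free
involutions: `M.1 i` is the partner of `i`. -/
def CompleteMatching (N : ℕ) : Type :=
  {f : Fin N → Fin N // ∀ i, f (f i) = i ∧ f i ≠ i}

namespace CompleteMatching

variable {N : ℕ}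

instance : Fintype (CompleteMatching N) :=
  inferInstanceAs (Fintype {f : Fin N → Fin N // ∀ i, f (f i) = i ∧ f i ≠ i})

/-- The nonnested edges, an edge being represented by its left endpoint `i` (so `i < M.1 i`):
there is no edge `{j, M.1 j}` with `j < i < M.1 i < M.1 j`. -/
def nonnested (M : CompleteMatching N) : Finset (Fin N) :=
  {i | i < M.1 i ∧ ∀ j, ¬ (j < i ∧ M.1 i < M.1 j)}

/-- Connected matchings: each point other than the first and the last one is nested by an edge. -/
def IsConnected (M : CompleteMatching N) : Prop :=
  ∀ k : Fin N, k.val ≠ 0 → k.val + 1 ≠ N → ∃ j, j < k ∧ k < M.1 j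

instance (M : CompleteMatching N) : Decidable M.IsConnected := by
  unfold IsConnected; infer_instance

end CompleteMatching

/-- The generating function of complete matchings of `N` points: a nonnested edge has weight `w`,
every other edge has weight `1`. -/
def completeMatchingGF {R : Type*} [CommRing R] (w : R) (N : ℕ) : R :=
  ∑ M : CompleteMatching N, ∏ _i ∈ M.nonnested, w

/-- The generating function of connected matchings of `N` points: a nonnested edge has weight `c`
unless it contains the first point; every other edge has weight `1`. -/
def connectedMatchingGF {R : Type*} [CommRing R] (c : R) (N : ℕ) : R :=
  ∑ M : CompleteMatching N with M.IsConnected, ∏ _i ∈ M.nonnested with _i.val ≠ 0, c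

/-! ## Rooted maps in orientable surfaces -/

/-- A rooted map with `n` edges in a closed oriented surface, with labelled half-edges
(edge ends). `vert` sends a half-edge to the next one counterclockwise around its vertex, `edge`
sends it to the other half of its edge, and `root` is the half-edge at the head of the root edge.
The map without edges (one vertex in the sphere) has no half-edge and no edge to orient; it is
the only element for `n = 0`. -/
@[ext]
structure LabelledRootedMap (n : ℕ) where
  vert : Equiv.Perm (Fin (2 * n))
  edge : Equiv.Perm (Fin (2 * n))
  edge_edge : ∀ d, edge (edge d) = d
  edge_ne : ∀ d, edge d ≠ d
  connected : MulAction.IsPretransitive (Subgroup.closure {vert, edge}) (Fin (2 * n))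
  root : 0 < n → Fin (2 * n)

namespace LabelledRootedMap

variable {n : ℕ}

/-- Isomorphism of rooted maps: a relabelling of the half-edges that respects the structure. -/
def Iso (m m' : LabelledRootedMap n) : Prop :=
  ∃ φ : Equiv.Perm (Fin (2 * n)), (∀ d, φ (m.vert d) = m'.vert (φ d)) ∧
    (∀ d, φ (m.edge d) = m'.edge (φ d)) ∧ ∀ h, φ (m.root h) = m'.root h

instance setoid (n : ℕ) : Setoid (LabelledRootedMap n) where
  r := Iso
  iseqv :=
    { refl := fun m => ⟨Equiv.refl _, by simp⟩
      symm := by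
        rintro m m' ⟨φ, hv, he, hr⟩
        refine ⟨φ.symm, fun d => ?_, fun d => ?_, fun h => ?_⟩
        · rw [Equiv.symm_apply_eq, hv, Equiv.apply_symm_apply]
        · rw [Equiv.symm_apply_eq, he, Equiv.apply_symm_apply]
        · rw [Equiv.symm_apply_eq, hr]
      trans := by
        rintro m m' m'' ⟨φ, hv, he, hr⟩ ⟨ψ, hv', he', hr'⟩
        exact ⟨φ.trans ψ, fun d => by simp [hv, hv'], fun d => by simp [he, he'],
          fun h => by simp [hr, hr']⟩ }

instance : Finite (LabelledRootedMap n) :=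
  Finite.of_injective
    (fun m : LabelledRootedMap n => (m.vert, m.edge, m.root)) (by
      intro m m' h
      simp only [Prod.mk.injEq] at h
      exact LabelledRootedMap.ext h.1 h.2.1 h.2.2)

/-- The vertices that have a half-edge (all vertices, unless `n = 0`): the cycles of `vert`. -/
def Vertex (m : LabelledRootedMap n) : Type :=
  Quotient (Equiv.Perm.SameCycle.setoid m.vert)

/-- The vertex of a half-edge. -/
def vertexOf (m : LabelledRootedMap n) (d : Fin (2 * n)) : m.Vertex :=
  Quotient.mk (Equiv.Perm.SameCycle.setoid m.vert) d

/-- The vertices other than the root vertex. The root vertex is the one at the head of the root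
edge; for `n = 0` it is the only vertex of the map. -/
def NonrootVertex (m : LabelledRootedMap n) : Type :=
  {v : m.Vertex // ∀ h, v ≠ m.vertexOf (m.root h)}

/-- The number of vertices other than the root vertex. -/
noncomputable def numNonroot (m : LabelledRootedMap n) : ℕ := Nat.card m.NonrootVertex

theorem numNonroot_eq_of_iso (m m' : LabelledRootedMap n) (h : Iso m m') :
    m.numNonroot = m'.numNonroot := by
  obtain ⟨φ, hv, -, hr⟩ := h
  have hc : m'.vert = φ * m.vert * φ⁻¹ := by
    ext d
    simp [hv]
  have hs : ∀ a b, (Equiv.Perm.SameCycle.setoid m.vert) a b ↔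
      (Equiv.Perm.SameCycle.setoid m'.vert) (φ a) (φ b) := by
    intro a b
    change m.vert.SameCycle a b ↔ m'.vert.SameCycle (φ a) (φ b)
    rw [hc, Equiv.Perm.sameCycle_conj]
    simp
  let e : m.Vertex ≃ m'.Vertex := Quotient.congr φ hs
  refine Nat.card_congr (e.subtypeEquiv fun v => ?_)
  refine forall_congr' fun h => not_congr ?_
  have : m'.vertexOf (m'.root h) = e (m.vertexOf (m.root h)) := by
    rw [← hr]; rfl
  rw [this, e.apply_eq_iff_eq]

end LabelledRootedMap

/-- Rooted maps with `n` edges in orientable surfaces. -/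
def RootedMap (n : ℕ) : Type := Quotient (LabelledRootedMap.setoid n)

instance (n : ℕ) : Finite (RootedMap n) :=
  inferInstanceAs (Finite (Quotient (LabelledRootedMap.setoid n)))

noncomputable instance (n : ℕ) : Fintype (RootedMap n) := Fintype.ofFinite _

/-- The number of vertices of a rooted map other than the root vertex. -/
noncomputable def RootedMap.numNonroot {n : ℕ} (m : RootedMap n) : ℕ :=
  Quotient.lift LabelledRootedMap.numNonroot LabelledRootedMap.numNonroot_eq_of_iso m

/-- The generating function of rooted maps with `n` edges in orientable surfaces: each vertex
other than the root vertex has weight `c`. -/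
noncomputable def rootedMapGF {R : Type*} [CommRing R] (c : R) (n : ℕ) : R :=
  ∑ m : RootedMap n, c ^ m.numNonroot

/-! All four quantities equal `pathWeight (c + 1) (2 * n) 0`, a sum over Dyck paths in which a down
step from height `k + 1` weighs `k + c + 1`.

For the moments this is the three-term recurrence, read as one step of a path
(`hermiteFunctional_X_pow_mul`). For matchings, the points are scanned from left to right and the
height is the number of open edges. An edge closed when `k + 1` are open is nonnested exactly when
it is the leftmost of them, so the choices contribute `k + w` (`openMatchingGF_step`,
`openMatchingGF_false`). In a connected matching the height stays at least 1 until the last point;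
lowering the path by one turns the weight `k + 1 + c` into `k + (c + 1)`, and the final down step
gives a factor `c` that stands for the edge of the first point (`openMatchingGF_true`).

For maps, let `F_c` be `pochhammerSeries c`. If `c` is a positive integer, `(2n)! [zⁿ] F_c` counts
the triples of a permutation, a pairing and a `c`-colouring of the cycles on `2n` points. Splitting
off the component of a marked point expresses these through connected triples, which are rooted maps
up to labelling: a rooted map has no nontrivial automorphism, so it has `(2n)!` labellings. The
result is `M_c F_c = F_{c+1}`, where `M_c` is the series of rooted maps
(`rootedMapSeries_mul_pochhammerSeries`). The path series satisfies the same equation, by the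
contiguous relation `F_{c+1} = F_c + (c+1) z F_{c+2}` (`pathSeries_mul_pochhammerSeries`). Equality
at all positive integers is a polynomial identity over `ℤ`, which specializes to every commutative
ring. -/

/-! ## Weighted Dyck paths -/

section Paths

variable {R : Type*} [CommRing R]

/-- The generating function of paths with `m` steps `±1` from height `h` to height `0` that stay
nonnegative, where a down step from height `k + 1` has weight `k + w`. -/
def pathWeight (w : R) : ℕ → ℕ → R
  | 0, 0 => 1
  | 0, _ + 1 => 0
  | m + 1, 0 => pathWeight w m 1
  | m + 1, h + 1 => pathWeight w m (h + 2) + ((h : R) + w) * pathWeight w m h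

theorem map_pathWeight {S : Type*} [CommRing S] (φ : R →+* S) (w : R) (m h : ℕ) :
    φ (pathWeight w m h) = pathWeight (φ w) m h := by
  induction m generalizing h with
  | zero => cases h <;> simp [pathWeight]
  | succ m ih => cases h <;> simp [pathWeight, ih]

theorem pathWeight_eq_zero_of_lt (w : R) {m h : ℕ} (hmh : m < h) : pathWeight w m h = 0 := by
  induction m generalizing h with
  | zero =>
    obtain ⟨k, rfl⟩ : ∃ k, h = k + 1 := ⟨h - 1, by omega⟩
    rw [pathWeight]
  | succ m ih =>
    obtain ⟨k, rfl⟩ : ∃ k, h = k + 1 := ⟨h - 1, by omega⟩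
    rw [pathWeight, ih (by omega), ih (by omega)]
    simp

/-- Multiplying `H_h` by `x` gives `H_{h+1}` plus a multiple of `H_{h-1}`: an up step or a weighted
down step. Orthogonality to `H_0` kills every path that does not end at height 0. A general starting
height is needed for the induction. -/
theorem hermiteFunctional_X_pow_mul (w : R) (m h : ℕ) :
    hermiteFunctional w (X ^ m * assocHermite w h) = pathWeight w m h := by
  have hL : IsHermiteFunctional w (hermiteFunctional w) :=
    (existsUnique_isHermiteFunctional w).choose_spec.1
  induction m generalizing h with
  | zero =>
    cases h with
    | zero => simp [pathWeight, assocHermite, hL.map_one]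
    | succ h => simpa [pathWeight, assocHermite] using hL.orthogonal (h + 1) 0 (by omega)
  | succ m ih =>
    cases h with
    | zero =>
      rw [pathWeight, ← ih]
      simp [assocHermite, pow_succ]
    | succ h =>
      have e : (X : R[X]) ^ (m + 1) * assocHermite w (h + 1) =
          X ^ m * assocHermite w (h + 2) + ((h : R) + w) • (X ^ m * assocHermite w h) := by
        rw [smul_eq_C_mul]
        linear_combination (X : R[X]) ^ m * X_mul_assocHermite w h
      rw [pathWeight, ← ih, ← ih, e, map_add, map_smul, smul_eq_mul]

theorem hermiteMoment_eq_pathWeight (w : R) (m : ℕ) : hermiteMoment w m = pathWeight w m 0 := by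
  simpa [assocHermite, hermiteMoment] using hermiteFunctional_X_pow_mul w m 0

end Paths

/-! ## Matchings as weighted paths -/

section Matchings

variable {N : ℕ}

/-- The involutions of `Fin N` whose fixed points are the points before `p` outside `A`, and
which send each point of `A` to a point from `p` on. -/
def openMatchings (A : Finset (Fin N)) (p : ℕ) : Finset (Fin N → Fin N) :=
  {f | (∀ i, f (f i) = i) ∧ (∀ i, f i = i ↔ i.val < p ∧ i ∉ A) ∧ ∀ i ∈ A, p ≤ (f i).val}

/-- The left ends of the nonnested edges of an involution. -/
def nonnestedLeft (f : Fin N → Fin N) : Finset (Fin N) :=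
  {i | i < f i ∧ ∀ j, ¬ (j < i ∧ f i < f j)}

/-- Each interior point from `p` on is nested by an edge. -/
def CoveredFrom (p : ℕ) (f : Fin N → Fin N) : Prop :=
  ∀ k : Fin N, p ≤ k.val → k.val ≠ 0 → k.val + 1 ≠ N → ∃ j, j < k ∧ k < f j

theorem mem_openMatchings {A : Finset (Fin N)} {p : ℕ} {f : Fin N → Fin N} :
    f ∈ openMatchings A p ↔
      (∀ i, f (f i) = i) ∧ (∀ i, f i = i ↔ i.val < p ∧ i ∉ A) ∧ ∀ i ∈ A, p ≤ (f i).val := by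
  simp [openMatchings]

theorem mem_nonnestedLeft {f : Fin N → Fin N} {i : Fin N} :
    i ∈ nonnestedLeft f ↔ i < f i ∧ ∀ j, ¬ (j < i ∧ f i < f j) := by
  simp [nonnestedLeft]

/-- The case in which the scan opens an edge at `q`. -/
theorem mem_openMatchings_and_lt_iff {A : Finset (Fin N)} (q : Fin N)
    (hA : ∀ i ∈ A, i.val < q.val) (f : Fin N → Fin N) :
    f ∈ openMatchings A q.val ∧ q < f q ↔ f ∈ openMatchings (insert q A) (q.val + 1) := by
  simp only [mem_openMatchings, Finset.mem_insert]
  constructor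
  · rintro ⟨⟨h1, h2, h3⟩, h4⟩
    refine ⟨h1, fun i => ?_, fun i hi => ?_⟩
    · rw [h2]; grind
    · rcases hi with rfl | hi
      · exact h4
      · have := h3 i hi
        have : f i ≠ q := by grind
        grind
  · rintro ⟨h1, h2, h3⟩
    refine ⟨⟨h1, fun i => ?_, fun i hi => ?_⟩, h3 q (by simp)⟩
    · rw [h2]; grind
    · have := h3 i (Or.inr hi); omega

/-- The case in which `q` closes the edge opened at `i`. Composing with the transposition deletes
this edge, since both of its ends become fixed points; the primed lemma below restores it. -/
theorem comp_swap_mem_openMatchings {A : Finset (Fin N)} {q i : Fin N} (hi : i ∈ A)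
    (hA : ∀ i ∈ A, i.val < q.val) {f : Fin N → Fin N} (hf : f ∈ openMatchings A q.val)
    (hq : f q = i) :
    f ∘ Equiv.swap i q ∈ openMatchings (A.erase i) (q.val + 1) := by
  simp only [mem_openMatchings, Finset.mem_erase, Function.comp, Equiv.swap_apply_def] at *
  obtain ⟨h1, h2, h3⟩ := hf
  have hfi : f i = q := by rw [← hq, h1]
  have hne : i ≠ q := by grind
  refine ⟨fun j => ?_, fun j => ?_, fun j hj => ?_⟩
  · grind
  · by_cases hji : j = i
    · grind
    by_cases hjq : j = q
    · grind
    simp only [hji, hjq, if_false, h2]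
    grind
  · have := h3 j hj.2
    have : f j ≠ q := by grind
    grind

theorem comp_swap_mem_openMatchings' {A : Finset (Fin N)} {q i : Fin N} (hi : i ∈ A)
    (hA : ∀ i ∈ A, i.val < q.val) {g : Fin N → Fin N}
    (hg : g ∈ openMatchings (A.erase i) (q.val + 1)) :
    g ∘ Equiv.swap i q ∈ openMatchings A q.val ∧ (g ∘ Equiv.swap i q) q = i := by
  simp only [mem_openMatchings, Finset.mem_erase, Function.comp, Equiv.swap_apply_def] at *
  obtain ⟨h1, h2, h3⟩ := hg
  have hi' := hA i hi
  have hgi : g i = i := by grind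
  have hgq : g q = q := by grind
  have hne : i ≠ q := by grind
  refine ⟨⟨fun j => ?_, fun j => ?_, fun j hj => ?_⟩, by simp [hne.symm, hgi]⟩
  · grind
  · by_cases hji : j = i
    · grind
    by_cases hjq : j = q
    · grind
    simp only [hji, hjq, if_false, h2]
    grind
  · by_cases hji : j = i
    · grind
    have := h3 j ⟨hji, hj⟩
    grind

/-- Every edge ends at `q` or later, because the points before `q` outside `A` are fixed. Hence the
edge from `i` to `q` nests no other edge and its deletion changes no other status. It is itself
nested exactly when some open point lies to the left of `i`. -/
theorem card_nonnestedLeft_comp_swap {A : Finset (Fin N)} {q i : Fin N} (hi : i ∈ A)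
    (hA : ∀ i ∈ A, i.val < q.val) {f : Fin N → Fin N} (hf : f ∈ openMatchings A q.val)
    (hq : f q = i) :
    (nonnestedLeft f).card =
      (nonnestedLeft (f ∘ Equiv.swap i q)).card + if ∀ j ∈ A, i ≤ j then 1 else 0 := by
  rw [mem_openMatchings] at hf
  obtain ⟨h1, h2, h3⟩ := hf
  have hfi : f i = q := by rw [← hq, h1]
  have hiq := hA i hi
  have hg : ∀ x, (f ∘ Equiv.swap i q) x = if x = i then i else if x = q then q else f x := by
    intro x
    simp only [Function.comp, Equiv.swap_apply_def]
    grind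
  have hother : ∀ j, j ≠ i → (j ∈ nonnestedLeft f ↔ j ∈ nonnestedLeft (f ∘ Equiv.swap i q)) := by
    intro j hj
    simp only [mem_nonnestedLeft, hg]
    by_cases hjq : j = q
    · grind
    simp only [hj, hjq, if_false]
    refine and_congr_right fun hlt => forall_congr' fun k => not_congr (and_congr_right fun hk => ?_)
    by_cases hki : k = i
    · have : q ≤ f j := by
        by_cases hjA : j ∈ A
        · exact h3 j hjA
        · by_contra hcon
          have := (h2 j).2 ⟨by omega, hjA⟩
          grind
      grind
    by_cases hkq : k = q
    · grind
    simp [hki, hkq]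
  have hself : i ∉ nonnestedLeft (f ∘ Equiv.swap i q) := by
    intro h
    have := (mem_nonnestedLeft.1 h).1
    rw [hg, if_pos rfl] at this
    exact this.false
  have hmem : i ∈ nonnestedLeft f ↔ ∀ j ∈ A, i ≤ j := by
    rw [mem_nonnestedLeft, hfi]
    constructor
    · rintro ⟨-, h⟩ j hj
      by_contra hcon
      have := h3 j hj
      have : f j ≠ q := by grind
      exact h j (by grind)
    · intro h
      refine ⟨hiq, fun j hj => ?_⟩
      have hjA : j ∉ A := fun hjA => by have := h j hjA; grind
      have := (h2 j).2 ⟨by grind, hjA⟩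
      grind
  split_ifs with hmin
  · have : nonnestedLeft f = insert i (nonnestedLeft (f ∘ Equiv.swap i q)) := by
      ext j; by_cases hj : j = i
      · subst hj; simp [hmem.2 hmin]
      · simp [hj, hother j hj]
    rw [this, Finset.card_insert_of_notMem hself]
  · rw [add_zero]
    congr 1
    ext j; by_cases hj : j = i
    · subst hj; simp only [hself, iff_false]; exact fun h => hmin (hmem.1 h)
    · exact hother j hj

/-- An edge passes over `q` exactly when it was opened at a point of `A`. In the closing case below,
the edge that ends at `q` has to be discounted. -/
theorem coveredFrom_iff_of_lt {A : Finset (Fin N)} {q : Fin N} {f : Fin N → Fin N}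
    (hA : ∀ i ∈ A, i.val < q.val) (hf : f ∈ openMatchings A q.val) (hq : q < f q) :
    CoveredFrom q.val f ↔
      (q.val ≠ 0 → q.val + 1 ≠ N → A.Nonempty) ∧ CoveredFrom (q.val + 1) f := by
  rw [mem_openMatchings] at hf
  obtain ⟨h1, h2, h3⟩ := hf
  have key : A.Nonempty ↔ ∃ j, j < q ∧ q < f j := by
    constructor
    · rintro ⟨j, hj⟩
      have := h3 j hj
      have : f j ≠ q := by grind
      exact ⟨j, hA j hj, by grind⟩
    · rintro ⟨j, hj, hj'⟩
      refine ⟨j, ?_⟩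
      by_contra hjA
      have := (h2 j).2 ⟨hj, hjA⟩
      grind
  rw [key]
  constructor
  · exact fun h => ⟨h q le_rfl, fun k hk => h k (by omega)⟩
  · rintro ⟨h, h'⟩ k hk
    rcases hk.eq_or_lt with hk | hk
    · obtain rfl : q = k := Fin.ext hk
      exact h
    · exact h' k hk

theorem coveredFrom_comp_swap_iff {A : Finset (Fin N)} {q i : Fin N} (hi : i ∈ A)
    (hA : ∀ i ∈ A, i.val < q.val) {f : Fin N → Fin N} (hf : f ∈ openMatchings A q.val)
    (hq : f q = i) :
    CoveredFrom q.val f ↔ (q.val ≠ 0 → q.val + 1 ≠ N → (A.erase i).Nonempty) ∧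
      CoveredFrom (q.val + 1) (f ∘ Equiv.swap i q) := by
  rw [mem_openMatchings] at hf
  obtain ⟨h1, h2, h3⟩ := hf
  have hfi : f i = q := by rw [← hq, h1]
  have hiq := hA i hi
  have key : (A.erase i).Nonempty ↔ ∃ j, j < q ∧ q < f j := by
    constructor
    · rintro ⟨j, hj⟩
      rw [Finset.mem_erase] at hj
      have := h3 j hj.2
      have : f j ≠ q := by grind
      exact ⟨j, hA j hj.2, by grind⟩
    · rintro ⟨j, hj, hj'⟩
      refine ⟨j, Finset.mem_erase.2 ⟨by grind, ?_⟩⟩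
      by_contra hjA
      have := (h2 j).2 ⟨hj, hjA⟩
      grind
  have hg : ∀ x, (f ∘ Equiv.swap i q) x = if x = i then i else if x = q then q else f x := by
    intro x
    simp only [Function.comp, Equiv.swap_apply_def]
    grind
  -- The deleted edge ends at `q`, so it nests no point beyond `q`.
  have key' : ∀ k : Fin N, q < k →
      ((∃ j, j < k ∧ k < f j) ↔ ∃ j, j < k ∧ k < (f ∘ Equiv.swap i q) j) := by
    intro k hk
    refine exists_congr fun j => and_congr_right fun hj => ?_
    rw [hg]
    grind
  rw [key]
  constructor
  · exact fun h => ⟨h q le_rfl, fun k hk h0 hN => (key' k hk).1 (h k (by omega) h0 hN)⟩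
  · rintro ⟨h, h'⟩ k hk
    rcases hk.eq_or_lt with hk | hk
    · obtain rfl : q = k := Fin.ext hk
      exact h
    · exact fun h0 hN => (key' k hk).2 (h' k hk h0 hN)

variable {R : Type*} [CommRing R]

open Classical in
/-- The generating function of `openMatchings A p` by nonnested edges, restricted to `CoveredFrom p`
if `b` holds. -/
noncomputable def openMatchingGF (w : R) (b : Prop) (A : Finset (Fin N)) (p : ℕ) : R :=
  ∑ f ∈ openMatchings A p with b → CoveredFrom p f, w ^ (nonnestedLeft f).card

-- One step of the scan: `q` either opens an edge or closes the one opened at some `i ∈ A`, with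
-- weight `w` if `i` is the leftmost open point. The side conditions keep an edge over `q` when
-- coverage is required.
open Classical in
theorem openMatchingGF_step (w : R) (b : Prop) {A : Finset (Fin N)} (q : Fin N)
    (hA : ∀ i ∈ A, i.val < q.val) :
    openMatchingGF w b A q.val =
      (if b → q.val ≠ 0 → q.val + 1 ≠ N → A.Nonempty then
        openMatchingGF w b (insert q A) (q.val + 1) else 0) +
      ∑ i ∈ A, if b → q.val ≠ 0 → q.val + 1 ≠ N → (A.erase i).Nonempty then
        (if ∀ j ∈ A, i ≤ j then w else 1) * openMatchingGF w b (A.erase i) (q.val + 1) else 0 := by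
  rw [openMatchingGF, ← Finset.sum_filter_add_sum_filter_not _ (fun f => q < f q)]
  congr 1
  · split_ifs with h
    · refine Finset.sum_congr ?_ fun _ _ => rfl
      ext f
      simp only [Finset.mem_filter]
      rw [← mem_openMatchings_and_lt_iff q hA]
      constructor
      · rintro ⟨⟨h1, h2⟩, h3⟩
        exact ⟨⟨h1, h3⟩, fun hb => ((coveredFrom_iff_of_lt hA h1 h3).1 (h2 hb)).2⟩
      · rintro ⟨⟨h1, h3⟩, h2⟩
        exact ⟨⟨h1, fun hb => (coveredFrom_iff_of_lt hA h1 h3).2 ⟨h hb, h2 hb⟩⟩, h3⟩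
    · refine Finset.sum_eq_zero fun f hf => absurd ?_ h
      simp only [Finset.mem_filter] at hf
      exact fun hb => ((coveredFrom_iff_of_lt hA hf.1.1 hf.2).1 (hf.1.2 hb)).1
  · rw [← Finset.sum_fiberwise_of_maps_to (t := A) (g := fun f => f q)]
    · refine Finset.sum_congr rfl fun i hi => ?_
      have hiq := hA i hi
      by_cases h : b → q.val ≠ 0 → q.val + 1 ≠ N → (A.erase i).Nonempty
      · rw [if_pos h, openMatchingGF, Finset.mul_sum]
        refine Finset.sum_bij' (fun f _ => f ∘ Equiv.swap i q) (fun f _ => f ∘ Equiv.swap i q)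
          ?_ ?_ ?_ ?_ ?_
        · intro f hf
          simp only [Finset.mem_filter] at hf ⊢
          obtain ⟨⟨⟨h1, h2⟩, h3⟩, h4⟩ := hf
          exact ⟨comp_swap_mem_openMatchings hi hA h1 h4,
            fun hb => ((coveredFrom_comp_swap_iff hi hA h1 h4).1 (h2 hb)).2⟩
        · intro g hg
          simp only [Finset.mem_filter] at hg ⊢
          obtain ⟨h1, h4⟩ := comp_swap_mem_openMatchings' hi hA hg.1
          refine ⟨⟨⟨h1, fun hb => (coveredFrom_comp_swap_iff hi hA h1 h4).2 ⟨h hb, ?_⟩⟩, ?_⟩, h4⟩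
          · have : (g ∘ Equiv.swap i q) ∘ Equiv.swap i q = g := by ext; simp
            rw [this]; exact hg.2 hb
          · rw [h4]; exact fun h => absurd h (by grind)
        · intro f _; ext; simp
        · intro f _; ext; simp
        · intro f hf
          simp only [Finset.mem_filter] at hf
          rw [card_nonnestedLeft_comp_swap hi hA hf.1.1.1 hf.2, pow_add, mul_comm]
          split_ifs <;> simp
      · rw [if_neg h]
        refine Finset.sum_eq_zero fun f hf => absurd ?_ h
        simp only [Finset.mem_filter] at hf
        exact fun hb => ((coveredFrom_comp_swap_iff hi hA hf.1.1.1 hf.2).1 (hf.1.1.2 hb)).1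
    · intro f hf
      simp only [Finset.mem_filter, mem_openMatchings] at hf
      obtain ⟨⟨⟨h1, h2, h3⟩, -⟩, h4⟩ := hf
      -- If `q` does not open an edge, its partner lies before `q`; outside `A` that partner would
      -- be a fixed point.
      have h5 : f q ≠ q := fun h => by have := (h2 q).1 h; omega
      by_contra hA'
      have := (h2 (f q)).2 ⟨by grind, hA'⟩
      grind

theorem openMatchingGF_length (w : R) (b : Prop) (A : Finset (Fin N)) :
    openMatchingGF w b A N = if A.card = 0 then 1 else 0 := by
  classical
  rw [openMatchingGF]
  split_ifs with h
  · obtain rfl := Finset.card_eq_zero.1 h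
    have : (openMatchings (∅ : Finset (Fin N)) N).filter (fun f => b → CoveredFrom N f) = {id} := by
      ext f
      simp only [Finset.mem_filter, mem_openMatchings, Finset.mem_singleton]
      constructor
      · rintro ⟨⟨-, h2, -⟩, -⟩
        ext i; rw [(h2 i).2 ⟨i.2, by simp⟩]; rfl
      · rintro rfl
        exact ⟨⟨by simp, by simp, by simp⟩, fun _ k hk => by omega⟩
    rw [this]
    simp [nonnestedLeft]
  · obtain ⟨i, hi⟩ := Finset.card_pos.1 (Nat.pos_of_ne_zero h)
    refine Finset.sum_eq_zero fun f hf => ?_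
    simp only [Finset.mem_filter, mem_openMatchings] at hf
    have := hf.1.2.2 i hi
    omega

theorem sum_ite_min_mul (w a : R) {A : Finset (Fin N)} (hA : A.Nonempty) :
    ∑ i ∈ A, (if ∀ j ∈ A, i ≤ j then w else 1) * a = ((A.card - 1 : ℕ) + w) * a := by
  classical
  rw [← Finset.sum_mul]
  congr 1
  have hmin : ∀ i ∈ A, (∀ j ∈ A, i ≤ j) ↔ i = A.min' hA := fun i hi =>
    ⟨fun h => le_antisymm (h _ (A.min'_mem hA)) (A.min'_le i hi),
      fun h j hj => h ▸ A.min'_le j hj⟩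
  rw [Finset.sum_congr rfl fun i hi => if_congr (hmin i hi) rfl rfl,
    ← Finset.add_sum_erase A _ (A.min'_mem hA), if_pos rfl,
    Finset.sum_congr rfl fun i hi => if_neg (Finset.ne_of_mem_erase hi)]
  simp [Finset.card_erase_of_mem (A.min'_mem hA), add_comm]

theorem openMatchingGF_false (w : R) (m : ℕ) : ∀ (A : Finset (Fin N)) (p : ℕ), p + m = N →
    (∀ i ∈ A, i.val < p) → openMatchingGF w False A p = pathWeight w m A.card := by
  induction m with
  | zero =>
    intro A p hp hA
    obtain rfl : p = N := by omega
    rw [openMatchingGF_length]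
    split_ifs with h
    · simp [h, pathWeight]
    · obtain ⟨k, hk⟩ : ∃ k, A.card = k + 1 :=
        ⟨A.card - 1, by omega⟩
      rw [hk, pathWeight]
  | succ m ih =>
    intro A p hp hA
    have hins : ∀ q : Fin N, q.val = p → ∀ i ∈ insert q A, i.val < p + 1 := by
      intro q hq i hi
      rcases Finset.mem_insert.1 hi with rfl | hi
      · omega
      · have := hA i hi; omega
    have hq : (⟨p, by omega⟩ : Fin N) ∉ A := fun h => by have := hA _ h; simp at this
    have := openMatchingGF_step w False ⟨p, by omega⟩ hA
    simp only [false_imp_iff, if_true] at this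
    rw [this, ih _ (p + 1) (by omega) (hins _ rfl), Finset.card_insert_of_notMem hq,
      Finset.sum_congr rfl fun i hi => by
        rw [ih (A.erase i) (p + 1) (by omega)
          (fun j hj => by have := hA j (Finset.mem_of_mem_erase hj); omega),
          Finset.card_erase_of_mem hi]]
    rcases A.eq_empty_or_nonempty with rfl | hne
    · simp [pathWeight]
    · rw [sum_ite_min_mul w _ hne]
      obtain ⟨k, hk⟩ : ∃ k, A.card = k + 1 := ⟨A.card - 1, by have := hne.card_pos; omega⟩
      rw [hk, pathWeight]; rfl

/-- With at least one edge always open, the height is `A.card - 1`, so every down-step weight gains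
1. The last point is exempt from coverage; it closes the last open edge, which is then the leftmost
one, whence the factor `c`. -/
theorem openMatchingGF_true (c : R) (m : ℕ) : ∀ (A : Finset (Fin N)) (p : ℕ), p + m + 1 = N →
    p ≠ 0 → (∀ i ∈ A, i.val < p) → A.Nonempty →
    openMatchingGF c True A p = c * pathWeight (c + 1) m (A.card - 1) := by
  induction m with
  | zero =>
    intro A p hp h0 hA hne
    have := openMatchingGF_step c True ⟨p, by omega⟩ hA
    have hN : p + 1 = N := hp
    simp only [hN, ne_eq, not_true_eq_false, false_imp_iff, imp_true_iff, if_true,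
      openMatchingGF_length] at this
    rw [this, if_neg (Finset.card_pos.2 (Finset.insert_nonempty _ _)).ne', zero_add,
      Finset.sum_congr rfl fun i hi => by rw [Finset.card_erase_of_mem hi],
      sum_ite_min_mul c _ hne]
    obtain ⟨k, hk⟩ : ∃ k, A.card = k + 1 := ⟨A.card - 1, by have := hne.card_pos; omega⟩
    rw [hk]
    cases k <;> simp [pathWeight]
  | succ m ih =>
    intro A p hp h0 hA hne
    have hins : ∀ q : Fin N, q.val = p → ∀ i ∈ insert q A, i.val < p + 1 := by
      intro q hq i hi
      rcases Finset.mem_insert.1 hi with rfl | hi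
      · omega
      · have := hA i hi; omega
    have hq : (⟨p, by omega⟩ : Fin N) ∉ A := fun h => by have := hA _ h; simp at this
    have hN : p + 1 ≠ N := by omega
    have := openMatchingGF_step c True ⟨p, by omega⟩ hA
    simp only [hN, h0, ne_eq, not_false_eq_true, true_imp_iff, hne, if_true] at this
    rw [this, ih _ (p + 1) (by omega) (by omega) (hins _ rfl) (Finset.insert_nonempty _ _),
      Finset.card_insert_of_notMem hq]
    obtain ⟨k, hk⟩ : ∃ k, A.card = k + 1 := ⟨A.card - 1, by have := hne.card_pos; omega⟩
    rcases k with _ | k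
    -- Closing the only open edge at an interior point would leave that point uncovered.
    · rw [hk, Finset.sum_eq_zero]
      · simp [pathWeight]
      · intro i hi
        rw [if_neg]
        rw [← Finset.card_pos, Finset.card_erase_of_mem hi, hk]
        omega
    · rw [Finset.sum_congr rfl fun i hi => by
        have hcard : (A.erase i).card = k + 1 := by rw [Finset.card_erase_of_mem hi, hk]; rfl
        have hne' : (A.erase i).Nonempty := Finset.card_pos.1 (by omega)
        rw [if_pos hne', ih (A.erase i) (p + 1) (by omega) (by omega)
          (fun j hj => by have := hA j (Finset.mem_of_mem_erase hj); omega) hne', hcard]]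
      rw [sum_ite_min_mul c _ hne, hk]
      simp only [Nat.add_sub_cancel, pathWeight]
      push_cast
      ring

theorem mem_openMatchings_empty {f : Fin N → Fin N} :
    f ∈ openMatchings ∅ 0 ↔ ∀ i, f (f i) = i ∧ f i ≠ i := by
  simp [mem_openMatchings, forall_and]

theorem completeMatchingGF_eq_pathWeight (w : R) (N : ℕ) :
    completeMatchingGF w N = pathWeight w N 0 := by
  classical
  have := openMatchingGF_false w N (∅ : Finset (Fin N)) 0 (by simp) (by simp)
  rw [Finset.card_empty] at this
  rw [← this, completeMatchingGF, openMatchingGF]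
  simp only [false_imp_iff, Finset.filter_true, Finset.prod_const]
  exact Finset.sum_bij (fun M _ => M.1) (fun M _ => mem_openMatchings_empty.2 M.2)
    (fun M _ M' _ h => Subtype.ext h)
    (fun f hf => ⟨⟨f, mem_openMatchings_empty.1 hf⟩, Finset.mem_univ _, rfl⟩)
    (fun M _ => rfl)

/-- The edge of the first point is always nonnested, so the factor `c` on the left gives it the same
weight as the other nonnested edges. -/
theorem mul_connectedMatchingGF (c : R) (n : ℕ) :
    c * connectedMatchingGF c (n + 2) = c * pathWeight (c + 1) n 0 := by
  classical
  have h1 := openMatchingGF_step c True (0 : Fin (n + 2)) (A := ∅) (by simp)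
  simp only [Fin.val_zero, ne_eq, not_true_eq_false, false_imp_iff, imp_true_iff, if_true,
    Finset.sum_empty, add_zero, zero_add, insert_empty_eq] at h1
  rw [openMatchingGF_true c n {0} 1 (by omega) (by omega) (by simp) (by simp)] at h1
  rw [Finset.card_singleton, Nat.sub_self] at h1
  rw [← h1, connectedMatchingGF, openMatchingGF, Finset.mul_sum]
  simp only [Finset.prod_const]
  refine Finset.sum_bij (fun M _ => M.1) ?_ (fun M _ M' _ h => Subtype.ext h) ?_ ?_
  · intro M hM
    simp only [Finset.mem_filter, mem_openMatchings_empty] at hM ⊢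
    exact ⟨M.2, fun _ k _ => hM.2 k⟩
  · intro f hf
    simp only [Finset.mem_filter, mem_openMatchings_empty] at hf
    exact ⟨⟨f, hf.1⟩, Finset.mem_filter.2 ⟨Finset.mem_univ _,
      fun k => hf.2 trivial k (Nat.zero_le _)⟩, rfl⟩
  · intro M _
    have h0 : (0 : Fin (n + 2)) ∈ nonnestedLeft M.1 := by
      rw [mem_nonnestedLeft]
      exact ⟨Fin.pos_iff_ne_zero.2 (M.2 0).2, fun j hj => absurd hj.1 (Fin.not_lt_zero j)⟩
    have h2 : {i ∈ M.nonnested | i.val ≠ 0} = (nonnestedLeft M.1).erase 0 := by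
      ext i
      rw [Finset.mem_filter, Finset.mem_erase, and_comm, ne_eq, ne_eq, Fin.ext_iff]
      rfl
    rw [h2, ← pow_succ', Finset.card_erase_add_one h0]

theorem connectedMatchingGF_eq_pathWeight (c : R) (n : ℕ) :
    connectedMatchingGF c (n + 2) = pathWeight (c + 1) n 0 := by
  -- In `R` the element `c` may be a zero divisor, so the cancellation takes place for an
  -- indeterminate over `ℤ`.
  have key : connectedMatchingGF (X : ℤ[X]) (n + 2) = pathWeight (X + 1) n 0 :=
    mul_left_cancel₀ X_ne_zero (mul_connectedMatchingGF X n)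
  have := congrArg (aeval c : ℤ[X] →ₐ[ℤ] R).toRingHom key
  rw [map_pathWeight] at this
  simpa [connectedMatchingGF] using this

end Matchings

/-! ## The power series of path weights -/

section Series

/-- The series `∑ (c)_{2n} zⁿ / (2ⁿ n!)`. -/
noncomputable def pochhammerSeries (c : ℚ) : PowerSeries ℚ :=
  PowerSeries.mk fun n => (ascPochhammer ℚ (2 * n)).eval c / (2 ^ n * n.factorial)

theorem ascPochhammer_eval_succ_left (c : ℚ) (n : ℕ) :
    (ascPochhammer ℚ (n + 1)).eval c = c * (ascPochhammer ℚ n).eval (c + 1) := by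
  rw [ascPochhammer_succ_left]; simp

theorem mul_ascPochhammer_eval_add_one (c : ℚ) (n : ℕ) :
    c * (ascPochhammer ℚ n).eval (c + 1) = (ascPochhammer ℚ n).eval c * (c + n) := by
  rw [← ascPochhammer_eval_succ_left, ascPochhammer_succ_eval]

/-- Coefficientwise, `(c+1)_{2n+2} - (c)_{2n+2} = (c+1)_{2n+1} ((c+2n+2) - c)`, and the factor `2n +
2` cancels against the denominator. -/
theorem pochhammerSeries_add_one (c : ℚ) :
    pochhammerSeries (c + 1) = pochhammerSeries c +
      PowerSeries.X * PowerSeries.C (c + 1) * pochhammerSeries (c + 2) := by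
  ext n
  rw [mul_assoc, map_add]
  cases n with
  | zero => simp [pochhammerSeries]
  | succ n =>
    rw [PowerSeries.coeff_succ_X_mul, PowerSeries.coeff_C_mul]
    simp only [pochhammerSeries, PowerSeries.coeff_mk]
    have h1 : (ascPochhammer ℚ (2 * (n + 1))).eval c =
        c * ((c + 1) * (ascPochhammer ℚ (2 * n)).eval (c + 2)) := by
      rw [show 2 * (n + 1) = 2 * n + 1 + 1 by ring, ascPochhammer_eval_succ_left,
        ascPochhammer_eval_succ_left]
      ring_nf
    have h2 : (ascPochhammer ℚ (2 * (n + 1))).eval (c + 1) =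
        (c + 1) * (ascPochhammer ℚ (2 * n)).eval (c + 2) * (c + 2 * n + 2) := by
      rw [show 2 * (n + 1) = 2 * n + 1 + 1 by ring, ascPochhammer_succ_eval,
        ascPochhammer_eval_succ_left]
      push_cast
      ring_nf
    rw [h1, h2, Nat.factorial_succ]
    have : (n.factorial : ℚ) ≠ 0 := by positivity
    push_cast
    field_simp
    ring

theorem coeff_zero_pochhammerSeries (c : ℚ) : PowerSeries.coeff 0 (pochhammerSeries c) = 1 := by
  simp [pochhammerSeries]

theorem pochhammerSeries_ne_zero (c : ℚ) : pochhammerSeries c ≠ 0 := fun h => by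
  simpa [h] using coeff_zero_pochhammerSeries c

/-- The series of weights of the paths from height `h` to height `0`, by number of up steps. -/
noncomputable def pathSeries (w : ℚ) (h : ℕ) : PowerSeries ℚ :=
  PowerSeries.mk fun n => pathWeight w (2 * n + h) h

theorem pathSeries_zero (w : ℚ) : pathSeries w 0 = 1 + PowerSeries.X * pathSeries w 1 := by
  ext n
  cases n with
  | zero => simp [pathSeries, pathWeight]
  | succ n =>
    rw [map_add, PowerSeries.coeff_succ_X_mul]
    simp only [pathSeries, PowerSeries.coeff_mk]
    rw [show 2 * (n + 1) + 0 = 2 * n + 1 + 1 by ring, pathWeight]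
    simp [PowerSeries.coeff_one]

theorem pathSeries_succ (w : ℚ) (h : ℕ) : pathSeries w (h + 1) =
    PowerSeries.X * pathSeries w (h + 2) + PowerSeries.C (h + w) * pathSeries w h := by
  ext n
  rw [map_add, PowerSeries.coeff_C_mul]
  cases n with
  | zero =>
    simp only [PowerSeries.coeff_zero_X_mul, pathSeries, PowerSeries.coeff_mk, mul_zero, zero_add]
    rw [pathWeight, pathWeight_eq_zero_of_lt _ (by omega), zero_add]
  | succ n =>
    rw [PowerSeries.coeff_succ_X_mul]
    simp only [pathSeries, PowerSeries.coeff_mk]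
    rw [show 2 * (n + 1) + (h + 1) = 2 * n + (h + 2) + 1 by ring, pathWeight,
      show 2 * (n + 1) + h = 2 * n + (h + 2) by ring]

/-- Both sides obey the same recurrence in `h`, by the contiguous relation. Their difference `E`
obeys it too, and this forces every coefficient of `E` to vanish, by induction on the degree and
then on `h`. -/
theorem pathSeries_mul_pochhammerSeries (c : ℚ) (h : ℕ) :
    pathSeries (c + 1) h * pochhammerSeries c =
      PowerSeries.C ((ascPochhammer ℚ h).eval (c + 1)) * pochhammerSeries (c + h + 1) := by
  let E : ℕ → PowerSeries ℚ := fun h => pathSeries (c + 1) h * pochhammerSeries c -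
    PowerSeries.C ((ascPochhammer ℚ h).eval (c + 1)) * pochhammerSeries (c + h + 1)
  have hE0 : E 0 = PowerSeries.X * E 1 := by
    have := pochhammerSeries_add_one c
    simp only [E, pathSeries_zero]
    simp only [ascPochhammer_zero, eval_one, map_one, Nat.cast_zero, Nat.cast_one, add_zero,
      ascPochhammer_one, eval_X]
    rw [show c + 1 + 1 = c + 2 by ring]
    linear_combination -this
  have hE : ∀ h, E (h + 1) = PowerSeries.X * E (h + 2) + PowerSeries.C (h + (c + 1)) * E h := by
    intro h
    have := pochhammerSeries_add_one (c + h + 1)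
    simp only [E]
    have e : (ascPochhammer ℚ (h + 2)).eval (c + 1) =
        (ascPochhammer ℚ (h + 1)).eval (c + 1) * (c + 1 + (h + 1 : ℕ)) :=
      ascPochhammer_succ_eval (h + 1) _
    rw [pathSeries_succ, e, ascPochhammer_succ_eval]
    push_cast
    rw [show c + (h + 1) + 1 = c + h + 1 + 1 by ring, show c + (h + 2) + 1 = c + h + 1 + 2 by ring,
      this, map_mul, map_mul, map_mul, show (c + 1 + h : ℚ) = h + (c + 1) by ring,
      show (c + 1 + (h + 1) : ℚ) = c + h + 1 + 1 by ring]
    ring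
  have key : ∀ n h, PowerSeries.coeff n (E h) = 0 := by
    intro n
    induction n with
    | zero =>
      intro h
      induction h with
      | zero => rw [hE0, PowerSeries.coeff_zero_X_mul]
      | succ h ih => rw [hE, map_add, PowerSeries.coeff_zero_X_mul, PowerSeries.coeff_C_mul, ih]; simp
    | succ n ihn =>
      intro h
      induction h with
      | zero => rw [hE0, PowerSeries.coeff_succ_X_mul, ihn]
      | succ h ih =>
        rw [hE, map_add, PowerSeries.coeff_succ_X_mul, PowerSeries.coeff_C_mul, ih, ihn]; simp
  exact sub_eq_zero.1 (PowerSeries.ext fun n => key n h)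

theorem pathSeries_zero_mul_pochhammerSeries (c : ℚ) :
    pathSeries (c + 1) 0 * pochhammerSeries c = pochhammerSeries (c + 1) := by
  simpa using pathSeries_mul_pochhammerSeries c 0

/-- At `c = 0` the denominator series is `1`, so the path series is `F_1` itself. This later counts
pairings. -/
theorem pathWeight_one (n : ℕ) :
    pathWeight (1 : ℚ) (2 * n) 0 = (2 * n).factorial / (2 ^ n * n.factorial) := by
  have h0 : pochhammerSeries 0 = 1 := by
    ext n
    cases n with
    | zero => simp [pochhammerSeries]
    | succ n =>
      simp [pochhammerSeries, PowerSeries.coeff_one, ascPochhammer_eval_zero]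
  have h1 := congrArg (PowerSeries.coeff n) (pathSeries_zero_mul_pochhammerSeries 0)
  rw [h0, mul_one] at h1
  simpa [pathSeries, pochhammerSeries, ascPochhammer_eval_one] using h1

end Series

/-! ## Coloured pairs of permutations and their components -/

section ColouredPairs

open Equiv

variable {α β σ τ : Type*}

/-- Fixed-point-free involutions. -/
def IsPairing (e : Perm α) : Prop := (∀ d, e (e d) = d) ∧ ∀ d, e d ≠ d

/-- The orbit of `a` under the monoid generated by `v` and `e`. -/
def component (v e : Perm α) (a : α) : Set α :=
  {y | ∀ P : Set α, a ∈ P → (∀ x ∈ P, v x ∈ P) → (∀ x ∈ P, e x ∈ P) → y ∈ P}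

theorem self_mem_component (v e : Perm α) (a : α) : a ∈ component v e a := fun _ h _ _ => h

theorem left_mem_component {v e : Perm α} {a x : α} (hx : x ∈ component v e a) :
    v x ∈ component v e a := fun P h hv he => hv x (hx P h hv he)

theorem right_mem_component {v e : Perm α} {a x : α} (hx : x ∈ component v e a) :
    e x ∈ component v e a := fun P h hv he => he x (hx P h hv he)

theorem component_subset {v e : Perm α} {a : α} {P : Set α} (h : a ∈ P) (hv : ∀ x ∈ P, v x ∈ P)
    (he : ∀ x ∈ P, e x ∈ P) : component v e a ⊆ P := fun _ hy => hy P h hv he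

theorem component_permCongr (φ : α ≃ β) (v e : Perm α) (a : α) :
    component (φ.permCongr v) (φ.permCongr e) (φ a) = φ '' component v e a := by
  apply Set.Subset.antisymm
  · refine component_subset ⟨a, self_mem_component v e a, rfl⟩ ?_ ?_
    · rintro _ ⟨x, hx, rfl⟩
      exact ⟨v x, left_mem_component hx, by simp⟩
    · rintro _ ⟨x, hx, rfl⟩
      exact ⟨e x, right_mem_component hx, by simp⟩
  · rw [Set.image_subset_iff]
    refine component_subset (self_mem_component _ _ _) (fun x hx => ?_) (fun x hx => ?_)
    · simpa using left_mem_component hx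
    · simpa using right_mem_component hx

theorem isPairing_permCongr (φ : α ≃ β) {e : Perm α} :
    IsPairing (φ.permCongr e) ↔ IsPairing e := by
  simp only [IsPairing, φ.surjective.forall]
  simp

/-- A permutation, a pairing, and a colouring of the cycles of the permutation. -/
def colouredPairs (K α : Type*) : Set (Perm α × Perm α × (α → K)) :=
  {x | IsPairing x.2.1 ∧ ∀ d, x.2.2 (x.1 d) = x.2.2 d}

/-- The coloured pairs for which the component of `a` is `A`. -/
def colouredPairsWith (K : Type*) (a : α) (A : Set α) : Set (Perm α × Perm α × (α → K)) :=
  {x | x ∈ colouredPairs K α ∧ component x.1 x.2.1 a = A}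

variable {K : Type*}

/-- Transport of triples along an equivalence. -/
def tripleCongr (K : Type*) (φ : α ≃ β) :
    Perm α × Perm α × (α → K) ≃ Perm β × Perm β × (β → K) :=
  φ.permCongr.prodCongr (φ.permCongr.prodCongr (φ.arrowCongr (Equiv.refl K)))

theorem tripleCongr_mem_colouredPairs (φ : α ≃ β) (x : Perm α × Perm α × (α → K)) :
    tripleCongr K φ x ∈ colouredPairs K β ↔ x ∈ colouredPairs K α := by
  simp [tripleCongr, colouredPairs, isPairing_permCongr, φ.forall_congr_left]

theorem card_colouredPairs_congr (K : Type*) (φ : α ≃ β) :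
    Nat.card (colouredPairs K α) = Nat.card (colouredPairs K β) :=
  Nat.card_congr ((tripleCongr K φ).subtypeEquiv fun x => (tripleCongr_mem_colouredPairs φ x).symm)

theorem card_colouredPairsWith_congr (K : Type*) (φ : α ≃ β) (a : α) (A : Set α) :
    Nat.card (colouredPairsWith K a A) = Nat.card (colouredPairsWith K (φ a) (φ '' A)) := by
  refine Nat.card_congr ((tripleCongr K φ).subtypeEquiv fun x => ?_)
  refine and_congr (tripleCongr_mem_colouredPairs φ x).symm ?_
  change _ ↔ component (φ.permCongr x.1) (φ.permCongr x.2.1) (φ a) = φ '' A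
  rw [component_permCongr, φ.injective.image_injective.eq_iff]

theorem isPairing_sumCongr {e₁ : Perm σ} {e₂ : Perm τ} :
    IsPairing (Equiv.sumCongr e₁ e₂) ↔ IsPairing e₁ ∧ IsPairing e₂ := by
  simp [IsPairing, Sum.forall]
  tauto

theorem component_sumCongr (v₁ e₁ : Perm σ) (v₂ e₂ : Perm τ) (a : σ) :
    component (Equiv.sumCongr v₁ v₂) (Equiv.sumCongr e₁ e₂) (Sum.inl a) =
      Sum.inl '' component v₁ e₁ a := by
  apply Set.Subset.antisymm
  · refine component_subset ⟨a, self_mem_component _ _ a, rfl⟩ ?_ ?_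
    · rintro _ ⟨x, hx, rfl⟩
      exact ⟨v₁ x, left_mem_component hx, by simp⟩
    · rintro _ ⟨x, hx, rfl⟩
      exact ⟨e₁ x, right_mem_component hx, by simp⟩
  · rw [Set.image_subset_iff]
    refine component_subset (self_mem_component _ _ _) (fun x hx => ?_) (fun x hx => ?_)
    · simpa using left_mem_component hx
    · simpa using right_mem_component hx

theorem exists_eq_sumCongr [Finite σ] [Finite τ] {v : Perm (σ ⊕ τ)}
    (h : ∀ x ∈ Set.range (Sum.inl : σ → σ ⊕ τ), v x ∈ Set.range (Sum.inl : σ → σ ⊕ τ)) :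
    ∃ (v₁ : Perm σ) (v₂ : Perm τ), v = Equiv.sumCongr v₁ v₂ := by
  obtain ⟨⟨v₁, v₂⟩, hv⟩ := Perm.mem_sumCongrHom_range_of_perm_mapsTo_inl (σ := v) h
  exact ⟨v₁, v₂, hv.symm⟩

theorem sumCongr_inj {v₁ v₁' : Perm σ} {v₂ v₂' : Perm τ}
    (h : Equiv.sumCongr v₁ v₂ = Equiv.sumCongr v₁' v₂') : v₁ = v₁' ∧ v₂ = v₂' :=
  Prod.ext_iff.1 (Perm.sumCongrHom_injective (a₁ := (v₁, v₂)) (a₂ := (v₁', v₂')) h)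

/-- When the left summand is a component, the permutation and the pairing both preserve it, so the
triple splits into a connected triple on the left and an arbitrary one on the right. -/
theorem card_colouredPairsWith_sum [Finite σ] [Finite τ] (K : Type*) (a : σ) :
    Nat.card (colouredPairsWith K (Sum.inl a : σ ⊕ τ) (Set.range Sum.inl)) =
      Nat.card (colouredPairsWith K a Set.univ) * Nat.card (colouredPairs K τ) := by
  rw [← Nat.card_prod]
  symm
  have hcomp : ∀ (v₁ e₁ : Perm σ) (v₂ e₂ : Perm τ),
      component (Equiv.sumCongr v₁ v₂) (Equiv.sumCongr e₁ e₂) (Sum.inl a) = Set.range Sum.inl ↔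
        component v₁ e₁ a = Set.univ := by
    intro v₁ e₁ v₂ e₂
    rw [component_sumCongr, ← Set.image_univ, Sum.inl_injective.image_injective.eq_iff]
  have hpair : ∀ (v₁ e₁ : Perm σ) (f₁ : σ → K) (v₂ e₂ : Perm τ) (f₂ : τ → K),
      (Equiv.sumCongr v₁ v₂, Equiv.sumCongr e₁ e₂, Sum.elim f₁ f₂) ∈ colouredPairs K (σ ⊕ τ) ↔
        (v₁, e₁, f₁) ∈ colouredPairs K σ ∧ (v₂, e₂, f₂) ∈ colouredPairs K τ := by
    intro v₁ e₁ f₁ v₂ e₂ f₂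
    simp only [colouredPairs, Set.mem_ofPred_eq, isPairing_sumCongr, Sum.forall]
    simp only [Equiv.sumCongr_apply, Sum.map_inl, Sum.map_inr, Sum.elim_inl, Sum.elim_inr]
    tauto
  refine Nat.card_congr (Equiv.ofBijective (fun y =>
    ⟨(Equiv.sumCongr y.1.1.1 y.2.1.1, Equiv.sumCongr y.1.1.2.1 y.2.1.2.1,
      Sum.elim y.1.1.2.2 y.2.1.2.2),
      (hpair _ _ _ _ _ _).2 ⟨y.1.2.1, y.2.2⟩, (hcomp _ _ _ _).2 y.1.2.2⟩) ⟨?_, ?_⟩)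
  · rintro ⟨⟨⟨v₁, e₁, f₁⟩, h₁⟩, ⟨⟨v₂, e₂, f₂⟩, h₂⟩⟩ ⟨⟨⟨v₁', e₁', f₁'⟩, h₁'⟩, ⟨⟨v₂', e₂', f₂'⟩, h₂'⟩⟩ h
    obtain ⟨rfl, rfl⟩ := sumCongr_inj (congrArg (fun z => z.1.1) h)
    obtain ⟨rfl, rfl⟩ := sumCongr_inj (congrArg (fun z => z.1.2.1) h)
    have hf : Sum.elim f₁ f₂ = Sum.elim f₁' f₂' := congrArg (fun z => z.1.2.2) h
    have hf₁ : f₁ = f₁' := funext fun x => congrFun hf (Sum.inl x)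
    have hf₂ : f₂ = f₂' := funext fun x => congrFun hf (Sum.inr x)
    simp [hf₁, hf₂]
  · rintro ⟨⟨v, e, f⟩, h, hA⟩
    obtain ⟨v₁, v₂, rfl⟩ := exists_eq_sumCongr (v := v) fun x hx => by
      rw [← hA] at hx ⊢; exact left_mem_component hx
    obtain ⟨e₁, e₂, rfl⟩ := exists_eq_sumCongr (v := e) fun x hx => by
      rw [← hA] at hx ⊢; exact right_mem_component hx
    obtain ⟨f₁, f₂, rfl⟩ : ∃ f₁ f₂, f = Sum.elim f₁ f₂ :=
      ⟨f ∘ Sum.inl, f ∘ Sum.inr, (Sum.elim_comp_inl_inr f).symm⟩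
    obtain ⟨h₁, h₂⟩ := (hpair _ _ _ _ _ _).1 h
    exact ⟨(⟨(v₁, e₁, f₁), h₁, (hcomp _ _ _ _).1 hA⟩, ⟨(v₂, e₂, f₂), h₂⟩), rfl⟩

/-- The number of coloured pairs on `m` points. -/
noncomputable def numPairs (K : Type*) (m : ℕ) : ℕ := Nat.card (colouredPairs K (Fin m))

/-- The number of connected coloured pairs on `m + 1` points. -/
noncomputable def numConnectedPairs (K : Type*) (m : ℕ) : ℕ :=
  Nat.card (colouredPairsWith K (0 : Fin (m + 1)) Set.univ)

theorem card_colouredPairs [Fintype α] (K : Type*) :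
    Nat.card (colouredPairs K α) = numPairs K (Fintype.card α) :=
  card_colouredPairs_congr K (Fintype.equivFin α)

theorem card_colouredPairsWith_univ [Fintype α] (K : Type*) (a : α) {m : ℕ}
    (h : Fintype.card α = m + 1) :
    Nat.card (colouredPairsWith K a Set.univ) = numConnectedPairs K m := by
  let ψ : α ≃ Fin (m + 1) := Fintype.equivFinOfCardEq h
  have := card_colouredPairsWith_congr K (ψ.trans (Equiv.swap (ψ a) 0)) a Set.univ
  simpa [numConnectedPairs, Set.image_univ, Equiv.range_eq_univ] using this

theorem card_colouredPairsWith [Fintype α] [DecidableEq α] (K : Type*) (a : α) {m : ℕ}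
    (hm : Fintype.card α = m + 1) (T : Finset α) (ha : a ∉ T) :
    Nat.card (colouredPairsWith K a {x | x ∉ T}) =
      numConnectedPairs K (m - T.card) * numPairs K T.card := by
  let φ : {x // x ∉ T} ⊕ {x // x ∈ T} ≃ α :=
    (Equiv.sumComm _ _).trans (Equiv.sumCompl (· ∈ T))
  have hφ : ∀ x : {x // x ∉ T}, φ (Sum.inl x) = x.1 := fun x => rfl
  have himg : φ '' Set.range Sum.inl = {x | x ∉ T} := by
    ext x
    constructor
    · rintro ⟨_, ⟨y, rfl⟩, rfl⟩
      exact y.2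
    · exact fun hx => ⟨_, ⟨⟨x, hx⟩, rfl⟩, rfl⟩
  have h1 := card_colouredPairsWith_congr K φ (Sum.inl ⟨a, ha⟩) (Set.range Sum.inl)
  have hT : Fintype.card {x // x ∉ T} = (m - T.card) + 1 := by
    have h2 : T.card < Fintype.card α :=
      Finset.card_lt_univ_of_notMem ha
    rw [Fintype.card_subtype_compl, Fintype.card_coe]
    omega
  rw [himg, hφ, card_colouredPairsWith_sum, card_colouredPairsWith_univ K _ hT,
    card_colouredPairs, Fintype.card_coe] at h1
  exact h1.symm

/-- Triples are sorted by the set of points outside the component of `0`, which is any subset of the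
other `m` points. -/
theorem numPairs_succ (K : Type*) [Finite K] (m : ℕ) :
    numPairs K (m + 1) = ∑ j ∈ Finset.range (m + 1),
      m.choose j * (numConnectedPairs K (m - j) * numPairs K j) := by
  classical
  have := Fintype.ofFinite K
  let T : Perm (Fin (m + 1)) × Perm (Fin (m + 1)) × (Fin (m + 1) → K) → Finset (Fin (m + 1)) :=
    fun x => {y | y ∉ component x.1 x.2.1 0}
  have hsum := Finset.card_eq_sum_card_fiberwise
    (s := (colouredPairs K (Fin (m + 1))).toFinset) (f := T)
    (t := (Finset.univ.erase (0 : Fin (m + 1))).powerset) (by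
      intro x _
      simp only [Finset.coe_powerset, Set.mem_preimage, Set.mem_powerset_iff, Finset.coe_subset]
      intro y hy
      rw [Finset.mem_erase]
      refine ⟨?_, Finset.mem_univ _⟩
      rintro rfl
      exact (Finset.mem_filter.1 hy).2 (self_mem_component _ _ _))
  have hfib : ∀ S ∈ (Finset.univ.erase (0 : Fin (m + 1))).powerset,
      (Finset.filter (fun x => T x = S) (colouredPairs K (Fin (m + 1))).toFinset).card =
        numConnectedPairs K (m - S.card) * numPairs K S.card := by
    intro S hS
    have h0 : (0 : Fin (m + 1)) ∉ S := fun h =>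
      Finset.notMem_erase _ _ (Finset.mem_powerset.1 hS h)
    rw [← card_colouredPairsWith K 0 (Fintype.card_fin (m + 1)) S h0, Nat.card_eq_card_toFinset]
    congr 1
    ext x
    rw [Finset.mem_filter, Set.mem_toFinset, Set.mem_toFinset]
    refine and_congr_right fun _ => ?_
    simp only [T, Finset.ext_iff, Set.ext_iff, Finset.mem_filter, Finset.mem_univ, true_and,
      Set.mem_ofPred_eq]
    exact forall_congr' fun y => by tauto
  rw [Finset.sum_congr rfl hfib, Finset.sum_powerset_apply_card
    (fun j => numConnectedPairs K (m - j) * numPairs K j)] at hsum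
  rw [numPairs, Nat.card_eq_card_toFinset, hsum]
  simp [Finset.card_erase_of_mem]

end ColouredPairs

/-! ## Counting coloured pairs -/

section Counting

open Equiv

/-- Permutations with a colouring of their cycles. -/
def colouredPerms (K α : Type*) : Set (Perm α × (α → K)) := {x | ∀ d, x.2 (x.1 d) = x.2 d}

/-- The permutation coded by `(i, v)` inserts `none` just before `i` in its cycle of `v`, or as a
fixed point if `i = none`. -/
theorem colouring_optionCongr_iff {K α : Type*} [DecidableEq α] (i : Option α) (v : Perm α)
    (f : Option α → K) :
    (∀ d, f (Perm.decomposeOption.symm (i, v) d) = f d) ↔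
      (∀ d, f (some (v d)) = f (some d)) ∧ f i = f none := by
  have h : ∀ d, Perm.decomposeOption.symm (i, v) d = Equiv.swap none i (optionCongr v d) := by
    intro d; simp
  simp only [h, Option.forall, optionCongr_apply, Option.map_none, Option.map_some,
    Equiv.swap_apply_left]
  constructor
  · rintro ⟨h1, h2⟩
    refine ⟨fun d => ?_, h1⟩
    have := h2 d
    by_cases hi : some (v d) = i
    · rw [hi, Equiv.swap_apply_right] at this
      rw [hi, h1, this]
    · rwa [Equiv.swap_apply_of_ne_of_ne (by simp) hi] at this
  · rintro ⟨h1, h2⟩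
    refine ⟨h2, fun d => ?_⟩
    by_cases hi : some (v d) = i
    · rw [hi, Equiv.swap_apply_right, ← h2, ← hi, h1]
    · rw [Equiv.swap_apply_of_ne_of_ne (by simp) hi, h1]

/-- A new fixed point takes any colour; a point inserted into an existing cycle takes the colour of
that cycle. Iteration gives the rising factorial. -/
theorem card_colouredPerms_option (K α : Type*) [Finite α] [Finite K] :
    Nat.card (colouredPerms K (Option α)) =
      Nat.card (colouredPerms K α) * (Nat.card K + Nat.card α) := by
  classical
  rw [← Nat.card_sum, ← Nat.card_prod]
  symm
  refine Nat.card_congr (Equiv.ofBijective (fun y => match y with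
    | (x, .inl k) => ⟨(Perm.decomposeOption.symm (none, x.1.1), fun d => d.elim k x.1.2),
        (colouring_optionCongr_iff _ _ _).2 ⟨x.2, rfl⟩⟩
    | (x, .inr a) => ⟨(Perm.decomposeOption.symm (some a, x.1.1), fun d => d.elim (x.1.2 a) x.1.2),
        (colouring_optionCongr_iff _ _ _).2 ⟨x.2, rfl⟩⟩) ⟨?_, ?_⟩)
  · rintro ⟨⟨⟨v, f⟩, h⟩, k | a⟩ ⟨⟨⟨v', f'⟩, h'⟩, k' | a'⟩ heq
    all_goals
      have hi := Perm.decomposeOption.symm.injective (congrArg (fun z => z.1.1) heq)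
      have hf := congrArg (fun z => z.1.2) heq
      simp only [Prod.mk.injEq, reduceCtorEq, false_and, Option.some.injEq, true_and] at hi
    · obtain rfl := hi
      have h1 : k = k' := congrFun hf none
      have h2 : f = f' := funext fun x => congrFun hf (some x)
      simp [h1, h2]
    · obtain ⟨rfl, rfl⟩ := hi
      have h2 : f = f' := funext fun x => congrFun hf (some x)
      simp [h2]
  · rintro ⟨⟨w, f⟩, h⟩
    obtain ⟨⟨i, v⟩, rfl⟩ := Perm.decomposeOption.symm.surjective w
    obtain ⟨h1, h2⟩ := (colouring_optionCongr_iff i v f).1 h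
    rcases i with _ | a
    · refine ⟨(⟨(v, fun d => f (some d)), h1⟩, .inl (f none)), Subtype.ext (Prod.ext rfl ?_)⟩
      ext d; cases d <;> rfl
    · refine ⟨(⟨(v, fun d => f (some d)), h1⟩, .inr a), Subtype.ext (Prod.ext rfl ?_)⟩
      ext d; cases d
      · exact h2
      · rfl

theorem card_colouredPerms (K α : Type*) [Finite α] [Finite K] :
    Nat.card (colouredPerms K α) = (ascPochhammer ℕ (Nat.card α)).eval (Nat.card K) := by
  induction α using Finite.induction_empty_option with
  | @of_equiv α β φ ih =>
    rw [← Nat.card_congr φ, ← ih]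
    refine (Nat.card_congr ((φ.permCongr.prodCongr
      (φ.arrowCongr (Equiv.refl K))).subtypeEquiv fun x => ?_)).symm
    simp [colouredPerms, φ.forall_congr_left]
  | h_empty =>
    have : colouredPerms K PEmpty = Set.univ := by ext; simp [colouredPerms]
    rw [this]
    simp
  | @h_option α _ ih =>
    rw [card_colouredPerms_option, ih, Finite.card_option, ascPochhammer_succ_eval]
    simp

theorem card_isPairing (m : ℕ) :
    Nat.card {e : Perm (Fin m) // IsPairing e} = Nat.card (CompleteMatching m) := by
  refine Nat.card_congr
    { toFun := fun e => ⟨e.1, fun i => ⟨e.2.1 i, e.2.2 i⟩⟩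
      invFun := fun M => ⟨Function.Involutive.toPerm M.1 fun i => (M.2 i).1,
        fun i => (M.2 i).1, fun i => (M.2 i).2⟩
      left_inv := fun e => by ext; rfl
      right_inv := fun M => rfl }

theorem card_completeMatching (m : ℕ) :
    (Nat.card (CompleteMatching m) : ℚ) = pathWeight 1 m 0 := by
  rw [← completeMatchingGF_eq_pathWeight]
  simp [completeMatchingGF, Nat.card_eq_fintype_card]

theorem numPairs_eq (K : Type*) [Finite K] (m : ℕ) :
    (numPairs K m : ℚ) = pathWeight 1 m 0 * (ascPochhammer ℚ m).eval (Nat.card K : ℚ) := by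
  have h : numPairs K m =
      Nat.card {e : Perm (Fin m) // IsPairing e} * Nat.card (colouredPerms K (Fin m)) := by
    rw [← Nat.card_prod]
    exact Nat.card_congr
      { toFun := fun x => (⟨x.1.2.1, x.2.1⟩, ⟨(x.1.1, x.1.2.2), x.2.2⟩)
        invFun := fun y => ⟨(y.2.1.1, y.1.1, y.2.1.2), y.1.2, y.2.2⟩
        left_inv := fun x => rfl
        right_inv := fun y => rfl }
  rw [h, card_colouredPerms, card_isPairing, Nat.cast_mul, card_completeMatching, Nat.card_fin,
    ascPochhammer_eval_cast]

theorem pathWeight_eq_zero_of_odd {R : Type*} [CommRing R] (w : R) {m h : ℕ} (hmh : Odd (m + h)) :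
    pathWeight w m h = 0 := by
  induction m generalizing h with
  | zero =>
    cases h with
    | zero => simp at hmh
    | succ h => rw [pathWeight]
  | succ m ih =>
    cases h with
    | zero => rw [pathWeight, ih]; exact hmh
    | succ h =>
      rw [pathWeight, ih, ih, mul_zero, add_zero]
      · rw [Nat.odd_iff] at hmh ⊢; omega
      · rw [Nat.odd_iff] at hmh ⊢; omega

theorem numPairs_eq_zero_of_odd (K : Type*) [Finite K] {m : ℕ} (hm : Odd m) : numPairs K m = 0 := by
  have h := numPairs_eq K m
  rw [pathWeight_eq_zero_of_odd 1 (by simpa using hm), zero_mul] at h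
  exact_mod_cast h

theorem numPairs_two_mul (K : Type*) [Finite K] (n : ℕ) :
    (numPairs K (2 * n) : ℚ) =
      (2 * n).factorial * PowerSeries.coeff n (pochhammerSeries (Nat.card K)) := by
  rw [numPairs_eq, pathWeight_one, pochhammerSeries, PowerSeries.coeff_mk]
  ring

theorem sum_range_two_mul {M : Type*} [AddCommMonoid M] (g : ℕ → M) (hg : ∀ j, Odd j → g j = 0)
    (n : ℕ) : ∑ j ∈ Finset.range (2 * n), g j = ∑ i ∈ Finset.range n, g (2 * i) := by
  induction n with
  | zero => simp
  | succ n ih =>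
    rw [show 2 * (n + 1) = 2 * n + 1 + 1 by ring, Finset.sum_range_succ, Finset.sum_range_succ, ih,
      Finset.sum_range_succ, hg (2 * n + 1) (by simp), add_zero]

/-- The root component of a coloured pair on `2n + 2` points. -/
theorem numPairs_two_mul_succ (K : Type*) [Finite K] (n : ℕ) :
    numPairs K (2 * (n + 1)) = ∑ i ∈ Finset.range (n + 1),
      (2 * n + 1).choose (2 * i) *
        (numConnectedPairs K (2 * (n - i) + 1) * numPairs K (2 * i)) := by
  rw [show 2 * (n + 1) = 2 * n + 1 + 1 by ring, numPairs_succ,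
    show 2 * n + 1 + 1 = 2 * (n + 1) by ring, sum_range_two_mul]
  · refine Finset.sum_congr rfl fun i hi => ?_
    rw [Finset.mem_range] at hi
    rw [show 2 * n + 1 - 2 * i = 2 * (n - i) + 1 by omega]
  · intro j hj
    rw [numPairs_eq_zero_of_odd K hj, mul_zero, mul_zero]

end Counting

/-! ## Rooted maps -/

section Maps

open Equiv LabelledRootedMap

variable {n : ℕ}

theorem component_eq_univ_iff {α : Type*} [Finite α] (v e : Perm α) (a : α) :
    component v e a = Set.univ ↔ MulAction.IsPretransitive (Subgroup.closure {v, e}) α := by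
  constructor
  · intro h
    have horb : component v e a ⊆ MulAction.orbit (Subgroup.closure {v, e}) a := by
      refine component_subset (MulAction.mem_orbit_self a) ?_ ?_
      · rintro _ ⟨g, rfl⟩
        exact ⟨⟨v, Subgroup.subset_closure (by simp)⟩ * g, rfl⟩
      · rintro _ ⟨g, rfl⟩
        exact ⟨⟨e, Subgroup.subset_closure (by simp)⟩ * g, rfl⟩
    rw [h] at horb
    refine ⟨fun x y => ?_⟩
    obtain ⟨g, hg⟩ := horb (Set.mem_univ x)
    obtain ⟨k, hk⟩ := horb (Set.mem_univ y)
    refine ⟨k * g⁻¹, ?_⟩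
    rw [← hg, ← hk]
    simp [mul_smul]
  · intro h
    refine Set.eq_univ_of_forall fun y => ?_
    obtain ⟨⟨g, hg⟩, rfl⟩ := MulAction.exists_smul_eq (Subgroup.closure {v, e}) a y
    have key : ∀ g ∈ Subgroup.closure {v, e}, ∀ x ∈ component v e a, g x ∈ component v e a := by
      intro g hg
      induction hg using Subgroup.closure_induction with
      | mem g hg =>
        rcases hg with rfl | rfl
        · exact fun x hx => left_mem_component hx
        · exact fun x hx => right_mem_component hx
      | one => exact fun x hx => hx
      | mul g k _ _ ihg ihk => exact fun x hx => ihg _ (ihk x hx)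
      | inv g _ ih =>
        intro x hx
        -- The component is only known to be stable forwards; finiteness makes `g` surjective on it,
        -- hence stable under the inverse.
        obtain ⟨y, hy⟩ := Finite.surjective_of_injective
          (f := fun y : component v e a => (⟨g y, ih y y.2⟩ : component v e a))
          (fun y z h => Subtype.ext (g.injective (congrArg Subtype.val h))) ⟨x, hx⟩
        have hy' : g y = x := congrArg Subtype.val hy
        rw [← hy', ← Perm.mul_apply, inv_mul_cancel]
        exact y.2
    exact key g hg a (self_mem_component v e a)

theorem apply_eq_of_sameCycle {α K : Type*} [Finite α] {v : Perm α} {f : α → K}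
    (hf : ∀ d, f (v d) = f d) {x y : α} (h : v.SameCycle x y) : f x = f y := by
  obtain ⟨i, rfl⟩ := h.exists_nat_pow_eq
  induction i with
  | zero => rfl
  | succ i ih => rw [pow_succ', Perm.mul_apply, hf]; exact ih ⟨i, by simp⟩

theorem card_colourings (K : Type*) (m : LabelledRootedMap n) :
    Nat.card {f : Fin (2 * n) → K // ∀ d, f (m.vert d) = f d} =
      Nat.card K ^ Nat.card m.Vertex := by
  have : Finite m.Vertex := inferInstanceAs (Finite (Quotient _))
  rw [← Nat.card_fun]
  exact Nat.card_congr
    { toFun := fun f => Quotient.lift f.1 fun _ _ h => apply_eq_of_sameCycle f.2 h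
      invFun := fun g => ⟨fun d => g (m.vertexOf d), fun d => by
        exact congrArg g (Quotient.sound (s := Perm.SameCycle.setoid m.vert)
          (Perm.sameCycle_apply_left.2 (Perm.SameCycle.refl _ _)))⟩
      left_inv := fun f => rfl
      right_inv := fun g => by ext x; induction x using Quotient.inductionOn; rfl }

theorem card_vertex (m : LabelledRootedMap n) (hn : 0 < n) :
    Nat.card m.Vertex = m.numNonroot + 1 := by
  classical
  have : Finite m.Vertex := inferInstanceAs (Finite (Quotient _))
  have e : m.NonrootVertex ≃ {v : m.Vertex // v ≠ m.vertexOf (m.root hn)} :=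
    Equiv.subtypeEquivRight fun v => ⟨fun h => h hn, fun h _ => h⟩
  have := Fintype.ofFinite m.Vertex
  have hpos : 0 < Fintype.card m.Vertex := Fintype.card_pos_iff.2 ⟨m.vertexOf (m.root hn)⟩
  rw [numNonroot, Nat.card_congr e, Nat.card_eq_fintype_card, Nat.card_eq_fintype_card,
    Fintype.card_subtype_compl, Fintype.card_subtype_eq]
  omega

/-- Relabelling of the half-edges. -/
def LabelledRootedMap.relabel (φ : Perm (Fin (2 * n))) (m : LabelledRootedMap n) :
    LabelledRootedMap n where
  vert := φ.permCongr m.vert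
  edge := φ.permCongr m.edge
  edge_edge d := by simp [m.edge_edge]
  edge_ne d := by
    intro h
    apply m.edge_ne (φ.symm d)
    apply φ.injective
    simpa using h
  connected := by
    rcases Nat.eq_zero_or_pos n with rfl | hn
    · exact ⟨fun x => x.elim0⟩
    · have h := (component_eq_univ_iff _ _ (m.root hn)).2 m.connected
      rw [← component_eq_univ_iff _ _ (φ (m.root hn)), component_permCongr, h, Set.image_univ,
        Equiv.range_eq_univ]
  root h := φ (m.root h)

/-- Two relabellings with the same result agree at the root, and their agreement set is stable under
`vert` and `edge`; connectedness makes it everything. -/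
theorem relabel_injective (m : LabelledRootedMap n) :
    Function.Injective fun φ => relabel φ m := by
  intro φ ψ h
  rcases Nat.eq_zero_or_pos n with rfl | hn
  · ext x; exact x.elim0
  have hv : φ.permCongr m.vert = ψ.permCongr m.vert := congrArg LabelledRootedMap.vert h
  have he : φ.permCongr m.edge = ψ.permCongr m.edge := congrArg LabelledRootedMap.edge h
  have hr : φ (m.root hn) = ψ (m.root hn) := congrArg (fun m => LabelledRootedMap.root m hn) h
  have hstep : ∀ σ : Perm (Fin (2 * n)), φ.permCongr σ = ψ.permCongr σ →
      ∀ x, φ x = ψ x → φ (σ x) = ψ (σ x) := by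
    intro σ hσ x hx
    have := Equiv.congr_fun hσ (φ x)
    simp only [Equiv.permCongr_apply, Equiv.symm_apply_apply] at this
    rw [this, hx, Equiv.symm_apply_apply]
  have huniv := (component_eq_univ_iff _ _ (m.root hn)).2 m.connected
  have hsub : component m.vert m.edge (m.root hn) ⊆ {x | φ x = ψ x} :=
    component_subset hr (hstep _ hv) (hstep _ he)
  rw [huniv] at hsub
  exact Equiv.ext fun x => hsub (Set.mem_univ x)

theorem iso_iff_exists_relabel (m m' : LabelledRootedMap n) :
    Iso m m' ↔ ∃ φ, relabel φ m = m' := by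
  constructor
  · rintro ⟨φ, hv, he, hr⟩
    refine ⟨φ, LabelledRootedMap.ext ?_ ?_ (funext hr)⟩
    · ext1 d; simp [relabel, hv]
    · ext1 d; simp [relabel, he]
  · rintro ⟨φ, rfl⟩
    exact ⟨φ, fun d => by simp [relabel], fun d => by simp [relabel], fun h => rfl⟩

/-- The rooted map of a labelled rooted map. -/
def LabelledRootedMap.toRootedMap (m : LabelledRootedMap n) : RootedMap n := Quotient.mk _ m

theorem card_labellings (q : RootedMap n) :
    Nat.card {m : LabelledRootedMap n // m.toRootedMap = q} =
      (2 * n).factorial := by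
  obtain ⟨m, rfl⟩ : ∃ m : LabelledRootedMap n, m.toRootedMap = q := Quotient.exists_rep q
  have e : Perm (Fin (2 * n)) ≃
      {m' : LabelledRootedMap n // m'.toRootedMap = m.toRootedMap} :=
    Equiv.ofBijective (fun φ => ⟨relabel φ m,
        Quotient.sound ((setoid n).symm ((iso_iff_exists_relabel _ _).2 ⟨φ, rfl⟩))⟩)
      ⟨fun φ ψ h => relabel_injective m (congrArg Subtype.val h), fun m' => by
        obtain ⟨φ, hφ⟩ := (iso_iff_exists_relabel m m'.1).1
          ((setoid n).symm (Quotient.exact m'.2))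
        exact ⟨φ, Subtype.ext hφ⟩⟩
  rw [← Nat.card_congr e, Nat.card_perm, Nat.card_fin]

noncomputable instance : Fintype (LabelledRootedMap n) := Fintype.ofFinite _

theorem sum_labelledRootedMap {R : Type*} [CommRing R] (c : R) (n : ℕ) :
    ∑ m : LabelledRootedMap n, c ^ m.numNonroot = (2 * n).factorial * rootedMapGF c n := by
  classical
  rw [← Finset.sum_fiberwise _ (LabelledRootedMap.toRootedMap), rootedMapGF,
    Finset.mul_sum]
  refine Finset.sum_congr rfl fun q _ => ?_
  rw [← card_labellings q, Nat.card_eq_fintype_card, Fintype.card_subtype, ← nsmul_eq_mul,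
    ← Finset.sum_const]
  refine Finset.sum_congr rfl fun m hm => ?_
  rw [← (Finset.mem_filter.1 hm).2]
  rfl

/-- Coloured labelled rooted maps as connected coloured pairs with a point. -/
def colouredMapEquiv (K : Type*) (hn : 0 < n) :
    (Σ m : LabelledRootedMap n, {f : Fin (2 * n) → K // ∀ d, f (m.vert d) = f d}) ≃
      Σ r : Fin (2 * n), colouredPairsWith K r Set.univ where
  toFun y := ⟨y.1.root hn, (y.1.vert, y.1.edge, y.2.1), ⟨⟨y.1.edge_edge, y.1.edge_ne⟩, y.2.2⟩,
    (component_eq_univ_iff _ _ _).2 y.1.connected⟩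
  invFun z := ⟨⟨z.2.1.1, z.2.1.2.1, z.2.2.1.1.1, z.2.2.1.1.2,
    (component_eq_univ_iff _ _ _).1 z.2.2.2, fun _ => z.1⟩, ⟨z.2.1.2.2, z.2.2.1.2⟩⟩
  left_inv _ := rfl
  right_inv _ := rfl

/-- Coloured labelled maps with `n + 1` edges are counted twice: by the `2n + 2` positions of the
root, and by the `(2n+2)!` labellings of each rooted map. The factor `Nat.card K` is the colour of
the root vertex. -/
theorem numConnectedPairs_eq (K : Type*) [Finite K] (n : ℕ) :
    (numConnectedPairs K (2 * n + 1) : ℚ) =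
      (2 * n + 1).factorial * (Nat.card K * rootedMapGF (Nat.card K : ℚ) (n + 1)) := by
  have h := Nat.card_congr (colouredMapEquiv K (Nat.succ_pos n))
  rw [Nat.card_sigma, Nat.card_sigma] at h
  simp only [card_colourings, card_vertex _ (Nat.succ_pos n), pow_succ, ← Finset.sum_mul] at h
  have hc : ∀ r : Fin (2 * (n + 1)), Nat.card (colouredPairsWith K r Set.univ) =
      numConnectedPairs K (2 * n + 1) := fun r =>
    card_colouredPairsWith_univ K r (by rw [Fintype.card_fin]; ring)
  rw [Finset.sum_congr rfl fun r _ => hc r] at h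
  have h' := congrArg (Nat.cast : ℕ → ℚ) h
  push_cast at h'
  rw [sum_labelledRootedMap, Finset.sum_const, Finset.card_univ, Fintype.card_fin, nsmul_eq_mul,
    show 2 * (n + 1) = 2 * n + 1 + 1 by ring, Nat.factorial_succ] at h'
  have h0 : ((2 * n + 1 + 1 : ℕ) : ℚ) ≠ 0 := by positivity
  apply mul_left_cancel₀ h0
  rw [← h']
  push_cast
  ring

theorem rootedMapGF_zero {R : Type*} [CommRing R] (c : R) : rootedMapGF c 0 = 1 := by
  have h := sum_labelledRootedMap c 0
  have huniq : ∀ m m' : LabelledRootedMap 0, m = m' := fun m m' =>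
    LabelledRootedMap.ext (Equiv.ext fun x => x.elim0) (Equiv.ext fun x => x.elim0)
      (funext fun h => absurd h (lt_irrefl 0))
  let m₀ : LabelledRootedMap 0 := ⟨1, 1, fun d => rfl, fun d => d.elim0, ⟨fun x => x.elim0⟩,
    fun h => absurd h (lt_irrefl 0)⟩
  have huniv : (Finset.univ : Finset (LabelledRootedMap 0)) = {m₀} :=
    Finset.eq_singleton_iff_unique_mem.2 ⟨Finset.mem_univ _, fun m _ => huniq m m₀⟩
  have hempty : IsEmpty m₀.NonrootVertex := ⟨fun v => by
    obtain ⟨d, -⟩ := Quotient.exists_rep v.1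
    exact d.elim0⟩
  have h0 : m₀.numNonroot = 0 := Nat.card_of_isEmpty
  rw [huniv, Finset.sum_singleton, h0] at h
  simpa using h.symm

theorem rootedMapSeries_mul_pochhammerSeries (c : ℕ) (hc : c ≠ 0) :
    PowerSeries.mk (rootedMapGF (c : ℚ)) * pochhammerSeries c = pochhammerSeries (c + 1) := by
  have hc' : (c : ℚ) ≠ 0 := by exact_mod_cast hc
  rw [mul_comm]
  ext n
  rw [PowerSeries.coeff_mul, Finset.Nat.sum_antidiagonal_eq_sum_range_succ_mk]
  cases n with
  | zero => simp [coeff_zero_pochhammerSeries, rootedMapGF_zero, -PowerSeries.coeff_zero_eq_constantCoeff]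
  | succ n =>
    set t : ℕ → ℚ := fun i => PowerSeries.coeff i (pochhammerSeries c) with ht
    have hrec := congrArg (Nat.cast : ℕ → ℚ) (numPairs_two_mul_succ (Fin c) n)
    push_cast at hrec
    have hterm : ∀ i ∈ Finset.range (n + 1),
        ((2 * n + 1).choose (2 * i) : ℚ) *
          (numConnectedPairs (Fin c) (2 * (n - i) + 1) * numPairs (Fin c) (2 * i)) =
        (2 * n + 1).factorial * c * (t i * rootedMapGF (c : ℚ) (n + 1 - i)) := by
      intro i hi
      rw [Finset.mem_range] at hi
      have hch := Nat.choose_mul_factorial_mul_factorial (n := 2 * n + 1) (k := 2 * i) (by omega)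
      rw [show 2 * n + 1 - 2 * i = 2 * (n - i) + 1 by omega] at hch
      rw [numConnectedPairs_eq, numPairs_two_mul, Nat.card_fin, ← hch,
        show n - i + 1 = n + 1 - i by omega]
      push_cast
      ring
    rw [Finset.sum_congr rfl hterm, ← Finset.mul_sum, numPairs_two_mul, Nat.card_fin,
      show 2 * (n + 1) = 2 * n + 1 + 1 by ring, Nat.factorial_succ] at hrec
    have hf : ((2 * n + 1).factorial : ℚ) ≠ 0 := by positivity
    have hsum : c * ∑ i ∈ Finset.range (n + 1), t i * rootedMapGF (c : ℚ) (n + 1 - i) =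
        (2 * n + 2) * t (n + 1) := by
      apply mul_left_cancel₀ hf
      rw [← mul_assoc, ← hrec]
      push_cast
      ring
    -- From `c (c+1)_m = (c)_m (c+m)` with `m = 2n + 2`: the component recursion supplies the part
    -- `2n + 2`, and the map without edges supplies the part `c`.
    have hshift : c * PowerSeries.coeff (n + 1) (pochhammerSeries (c + 1)) =
        t (n + 1) * (c + (2 * n + 2)) := by
      simp only [ht, pochhammerSeries, PowerSeries.coeff_mk]
      rw [← mul_div_assoc, mul_ascPochhammer_eval_add_one]
      push_cast
      ring
    simp only [PowerSeries.coeff_mk]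
    apply mul_left_cancel₀ hc'
    rw [hshift, Finset.sum_range_succ, Nat.sub_self, rootedMapGF_zero, mul_add, hsum]
    simp only [ht]
    ring

theorem rootedMapGF_natCast (c : ℕ) (hc : c ≠ 0) (n : ℕ) :
    rootedMapGF (c : ℚ) n = pathWeight ((c : ℚ) + 1) (2 * n) 0 := by
  have h : PowerSeries.mk (rootedMapGF (c : ℚ)) = pathSeries (c + 1) 0 :=
    mul_right_cancel₀ (pochhammerSeries_ne_zero c)
      ((rootedMapSeries_mul_pochhammerSeries c hc).trans
        (pathSeries_zero_mul_pochhammerSeries c).symm)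
  simpa [pathSeries] using congrArg (PowerSeries.coeff n) h

theorem map_rootedMapGF {R S : Type*} [CommRing R] [CommRing S] (φ : R →+* S) (c : R) (n : ℕ) :
    φ (rootedMapGF c n) = rootedMapGF (φ c) n := by
  simp [rootedMapGF]

theorem rootedMapGF_eq_pathWeight {R : Type*} [CommRing R] (c : R) (n : ℕ) :
    rootedMapGF c n = pathWeight (c + 1) (2 * n) 0 := by
  have key : rootedMapGF (X : ℤ[X]) n = pathWeight (X + 1) (2 * n) 0 := by
    -- The evaluation points are `k + 1` because the colour count had to be cancelled as a nonzero
    -- factor.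
    refine Polynomial.eq_of_infinite_eval_eq _ _ (Set.infinite_of_injective_forall_mem
      (f := fun k : ℕ => ((k + 1 : ℕ) : ℤ)) (fun a b h => by simpa using h) fun k => ?_)
    change (evalRingHom ((k + 1 : ℕ) : ℤ)) _ = (evalRingHom ((k + 1 : ℕ) : ℤ)) _
    apply (Int.castRingHom ℚ).injective_int
    rw [map_rootedMapGF, map_rootedMapGF, map_pathWeight, map_pathWeight]
    simpa using rootedMapGF_natCast (k + 1) (Nat.succ_ne_zero k) n
  have := congrArg (aeval c : ℤ[X] →ₐ[ℤ] R).toRingHom key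
  rw [map_pathWeight, map_rootedMapGF] at this
  simpa using this

end Maps

theorem theoremt {R : Type*} [CommRing R] (c : R) (n : ℕ) :
    rootedMapGF c n = hermiteMoment (c + 1) (2 * n) ∧
    connectedMatchingGF c (2 * n + 2) = hermiteMoment (c + 1) (2 * n) ∧
    completeMatchingGF (c + 1) (2 * n) = hermiteMoment (c + 1) (2 * n) := by
  rw [hermiteMoment_eq_pathWeight]
  exact ⟨rootedMapGF_eq_pathWeight c n, connectedMatchingGF_eq_pathWeight c (2 * n),
    completeMatchingGF_eq_pathWeight (c + 1) (2 * n)⟩
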